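/- Let $d,L\ge 1$. A *cylindric shape* of period $(d,L)$ is a weakly decreasing sequence of integers $\lambda=(\lambda_i)_{i\in\mathbb Z}$ with $\lambda_i=\lambda_{i+d}+L$ for all $i$. Write $\mu\subseteq\lambda$ if $\mu_i\le\lambda_i$ for all $i$. The *cells* are the classes $\langle i,j\rangle=(i,j)+\mathbb Z(-d,L)$ of $(i,j)\in\mathbb Z^2$ (row $i$, column $j$). For $\mu\subseteq\lambda$ let $Y_{\lambda/\mu}=\{\langle i,j\rangle:\mu_i<j\le\lambda_i\}$, a finite set with $|\lambda/\mu|=\sum_{i=1}^d(\lambda_i-\mu_i)$ elements. A *standard cylindric tableau* of shape $\lambda/\mu$ (inner shape $\mu$, outer shape $\lambda$) is a bijection $T:Y_{\lambda/\mu}\to\{1,\dots,|\lambda/\mu|\}$ that increases along rows, $T(\langle i,j\rangle)<T(\langle i,j+1\rangle)$, and along columns, $T(\langle i,j\rangle)<T(\langle i+1,j\rangle)$, whenever both cells are in $Y_{\lambda/\mu}$; $\mathrm{SCT}(\lambda/\mu)$ denotes the set of these. *Internal insertion* in $T\in\mathrm{SCT}(\lambda/\mu)$ at a row $i$ with $\mu_{i-1}>\mu_i$: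 if the cell $\langle i,\mu_i+1\rangle$ contains no entry, add $1$ to both $\lambda_i$ and $\mu_i$ and keep the entries. Otherwise let $a$ be the entry of this cell; remove the cell (adding $1$ to $\mu_i$) and insert $a$ into row $i+1$, where to insert $a$ into row $r$ means the following: if $a$ is larger than all the entries of row $r$, place $a$ in the new cell $\langle r,\lambda_r+1\rangle$ (adding $1$ to $\lambda_r$) and stop; otherwise let $a$ replace the smallest entry $a'>a$ of row $r$, and insert $a'$ into row $r+1$. In both cases exactly one cell is added to the outer shape; the insertion is said to *terminate* at that cell. (A change in row $i$ of a shape is made in all rows congruent to $i$ modulo $d$.) *The algorithm* $\mathrm{CRS}$: for $T\in\mathrm{SCT}(\alpha/\mu)$ and $U\in\mathrm{SCT}(\beta/\mu)$ with $m=|\beta/\mu|$, let $P_0=T$ and let $Q_0$ be the empty tableau of shape $\alpha/\alpha$. For $k=1,\dots,m$, let $i\in\{1,\dots,d\}$ be the row of $U$ that contains $k$, let $P_k$ be obtained from $P_{k-1}$ by internal insertion at row $i$, and let $Q_k$ be obtained from $Q_{k-1}$ by placing $k$ in the cell at which this insertion terminates. Put $\mathrm{CRS}(T,U)=(P_m,Q_m)$.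 When $T=U$, the two components of $\mathrm{CRS}(T,T)$ coincide, and $\Phi(T)$ denotes this tableau; that is, $\Phi(T)$ is the first component of $\mathrm{CRS}(T,T)$. *Complements*: $\overline\lambda$ is the shape with $\overline\lambda_i=L-\lambda_{d+1-i}$ for all $i$. For $T\in\mathrm{SCT}(\lambda/\mu)$ with $n=|\lambda/\mu|$, the complement $\overline T\in\mathrm{SCT}(\overline\mu/\overline\lambda)$ is given by $\overline T(\langle d+1-i,L+1-j\rangle)=n+1-T(\langle i,j\rangle)$ for $\langle i,j\rangle\in Y_{\lambda/\mu}$. **Statement.** Let $T,U,P,Q$ be standard cylindric tableaux of period $(d,L)$ such that $T$ and $U$ have the same inner shape, and $P$ and $Q$ have the same outer shape. Then $$\mathrm{CRS}(T,U)=(P,Q)\quad\text{if and only if}\quad \mathrm{CRS}(\overline P,\overline Q)=(\overline T,\overline U).$$ In particular, for all standard cylindric tableaux $T$ and $P$ of period $(d,L)$, $\Phi(T)=P$ if and only if $\Phi(\overline P)=\overline T$. -/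

import Mathlib

namespace Cylindric

/-- A cylindric shape of period `(d, L)`: a doubly infinite weakly decreasing sequence of
integers `row i` with `row i = row (i + d) + L`. -/
@[ext]
structure Shape (d L : ℕ) where
  row : ℤ → ℤ
  antitone : Antitone row
  period : ∀ i, row i = row (i + d) + L

/-- The cylinder `ℤ² / (-d, L)ℤ`; its elements are the cells. -/
abbrev Cell (d L : ℕ) : Type :=
  (ℤ × ℤ) ⧸ AddSubgroup.zmultiples ((-(d : ℤ), (L : ℤ)) : ℤ × ℤ)

/-- The cell `⟨i, j⟩`, in row `i` and column `j`. -/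
def cell (d L : ℕ) (i j : ℤ) : Cell d L :=
  QuotientAddGroup.mk (i, j)

namespace Shape

variable {d L : ℕ}

theorem row_lt_of_dvd (lam : Shape d L) {r k : ℤ} (h : lam.row r < lam.row (r - 1))
    (hk : (d : ℤ) ∣ k - r) : lam.row k < lam.row (k - 1) := by
  have key : ∀ (i : ℤ) (n : ℕ), lam.row i = lam.row (i + n * d) + n * L := by
    intro i n
    induction n with
    | zero => simp
    | succ n ih =>
      have h1 := lam.period (i + n * d)
      have h2 : i + ((n + 1 : ℕ) : ℤ) * d = i + n * d + d := by push_cast; ring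
      rw [h2]; push_cast; linarith
  obtain ⟨q, hq⟩ := hk
  obtain ⟨n, hn | hn⟩ := Int.eq_nat_or_neg q
  · have h1 := key r n
    have h2 := key (r - 1) n
    have e1 : r + n * d = k := by subst hn; linarith
    have e2 : r - 1 + n * d = k - 1 := by subst hn; linarith
    rw [e1] at h1; rw [e2] at h2; linarith
  · have h1 := key k n
    have h2 := key (k - 1) n
    have e1 : k + n * d = r := by subst hn; linarith
    have e2 : k - 1 + n * d = r - 1 := by subst hn; linarith
    rw [e1] at h1; rw [e2] at h2; linarith

/-- The shape obtained from `lam` by adding a cell to row `r`. This is possible exactly when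
`lam.row r < lam.row (r - 1)`; otherwise the value is `lam`. -/
def addCell (lam : Shape d L) (r : ℤ) : Shape d L :=
  if h : lam.row r < lam.row (r - 1) then
    { row := fun k => if (d : ℤ) ∣ k - r then lam.row k + 1 else lam.row k
      antitone := by
        intro k l hkl
        rcases hkl.eq_or_lt with rfl | hlt
        · exact le_rfl
        · have h0 : lam.row l ≤ lam.row k := lam.antitone hkl
          have h1 : lam.row (l - 1) ≤ lam.row k := lam.antitone (by omega)
          by_cases hl : (d : ℤ) ∣ l - r
          · have h2 := lam.row_lt_of_dvd h hl
            simp only [hl, if_true]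
            split_ifs <;> omega
          · simp only [hl, if_false]
            split_ifs <;> omega
      period := by
        intro k
        have h1 : ((d : ℤ) ∣ k + d - r) ↔ ((d : ℤ) ∣ k - r) := by
          have e : k + d - r = (k - r) + d := by ring
          rw [e, dvd_add_self_right]
        have h2 := lam.period k
        simp only [h1]
        split_ifs <;> omega }
  else lam

/-- The complement of a shape: `[L - lam_d, L - lam_{d-1}, …, L - lam_1]`. -/
def complement (lam : Shape d L) : Shape d L where
  row i := L - lam.row (d + 1 - i)
  antitone := by
    intro k l hkl
    have h := lam.antitone (show (d : ℤ) + 1 - l ≤ d + 1 - k by omega)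
    simp only
    omega
  period := by
    intro k
    have h := lam.period (d + 1 - (k + d))
    have e : (d : ℤ) + 1 - (k + d) + d = d + 1 - k := by ring
    rw [e] at h
    omega

end Shape

/-- The `180°` rotation `⟨i, j⟩ ↦ ⟨d + 1 - i, L + 1 - j⟩` of the cylinder. -/
def Cell.rotate {d L : ℕ} (c : Cell d L) : Cell d L :=
  cell d L (d + 1) (L + 1) - c

theorem Cell.rotate_cell (d L : ℕ) (i j : ℤ) :
    Cell.rotate (cell d L i j) = cell d L (d + 1 - i) (L + 1 - j) := rfl

/-- Two shapes together with a filling of the cylinder by natural numbers, where the entry `0`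
marks an empty cell. -/
@[ext]
structure Filling (d L : ℕ) where
  inner : Shape d L
  outer : Shape d L
  entry : Cell d L → ℕ

namespace Filling

variable {d L : ℕ}

/-- The cylindric Young diagram of shape `outer / inner`. -/
def cells (T : Filling d L) : Set (Cell d L) :=
  {c | ∃ i j : ℤ, c = cell d L i j ∧ T.inner.row i < j ∧ j ≤ T.outer.row i}

/-- The number `∑_{i=1}^d (outer_i - inner_i)` of cells (when `inner ⊆ outer`). -/
noncomputable def size (T : Filling d L) : ℕ :=
  (∑ i ∈ Finset.Icc (1 : ℤ) d, (T.outer.row i - T.inner.row i)).toNat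

/-- `T` is a standard cylindric tableau of shape `T.outer / T.inner`. -/
structure IsStandard (T : Filling d L) : Prop where
  inner_le_outer : ∀ i, T.inner.row i ≤ T.outer.row i
  entry_eq_zero : ∀ c, c ∉ T.cells → T.entry c = 0
  bijOn : Set.BijOn T.entry T.cells (Set.Icc 1 T.size)
  row_lt : ∀ i j, cell d L i j ∈ T.cells → cell d L i (j + 1) ∈ T.cells →
    T.entry (cell d L i j) < T.entry (cell d L i (j + 1))
  col_lt : ∀ i j, cell d L i j ∈ T.cells → cell d L (i + 1) j ∈ T.cells →
    T.entry (cell d L i j) < T.entry (cell d L (i + 1) j)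

open Classical in
/-- The complement of a tableau: the entry of the complement in the rotation of a cell `c` of `T`
is `n + 1 - T(c)`, where `n` is the number of cells. (Rotation is an involution.) -/
noncomputable def complement (T : Filling d L) : Filling d L where
  inner := T.outer.complement
  outer := T.inner.complement
  entry c := if c.rotate ∈ T.cells then T.size + 1 - T.entry c.rotate else 0

/-- The empty tableau of shape `lam / lam`. -/
def empty (lam : Shape d L) : Filling d L where
  inner := lam
  outer := lam
  entry _ := 0

open Classical in
/-- Place `a` in a new cell at the end of row `r`, changing the outer shape. -/
noncomputable def append (T : Filling d L) (r : ℤ) (a : ℕ) : Filling d L where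
  inner := T.inner
  outer := T.outer.addCell r
  entry := Function.update T.entry (cell d L r (T.outer.row r + 1)) a

/-- Replace the entry `b` by `a`. -/
def replaceEntry (T : Filling d L) (b a : ℕ) : Filling d L where
  inner := T.inner
  outer := T.outer
  entry c := if T.entry c = b then a else T.entry c

/-- The entries `b ≤ n` of row `r` that are larger than `a`. -/
def largerEntries (T : Filling d L) (n : ℕ) (r : ℤ) (a : ℕ) : Set ℕ :=
  {b | a < b ∧ b ≤ n ∧ ∃ j : ℤ, T.entry (cell d L r j) = b}

open Classical in
/-- Insert `a` into row `r`: if row `r` has an entry larger than `a`, then `a` replaces the smallest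
such entry `b`, and `b` is inserted into row `r + 1`; otherwise `a` is placed in a new cell at the
end of row `r`. Here `n` is an upper bound for all entries. The result is the new filling together with the row
in which the process terminates. -/
noncomputable def rowInsert (n : ℕ) (T : Filling d L) (r : ℤ) (a : ℕ) : Filling d L × ℤ :=
  if _h : (T.largerEntries n r a).Nonempty then
    rowInsert n (T.replaceEntry (sInf (T.largerEntries n r a)) a) (r + 1)
      (sInf (T.largerEntries n r a))
  else
    (T.append r a, r)
termination_by n - a
decreasing_by
  have h := Nat.sInf_mem _h
  have h1 : a < sInf (T.largerEntries n r a) := h.1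
  have h2 : sInf (T.largerEntries n r a) ≤ n := h.2.1
  omega

open Classical in
/-- Internal insertion in `T` at row `i`. The result is the new filling together with the row to
which a cell of the outer shape is added. -/
noncomputable def internalInsert (T : Filling d L) (i : ℤ) : Filling d L × ℤ :=
  let c := cell d L i (T.inner.row i + 1)
  if T.entry c = 0 then
    ({ inner := T.inner.addCell i, outer := T.outer.addCell i, entry := T.entry }, i)
  else
    rowInsert T.size
      { inner := T.inner.addCell i, outer := T.outer, entry := Function.update T.entry c 0 }
      (i + 1) (T.entry c)

open Classical in
/-- The row `i ∈ {1, …, d}` of `U` that contains the entry `k`. -/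
noncomputable def rowOf (U : Filling d L) (k : ℕ) : ℤ :=
  if h : ∃ i : ℤ, 1 ≤ i ∧ i ≤ d ∧ ∃ j : ℤ, U.entry (cell d L i j) = k then h.choose else 0

/-- The pairs `(P_k, Q_k)` in the computation of the cylindric Robinson–Schensted algorithm:
`P_0 = T`, `Q_0` is empty of shape `T.outer / T.outer`, and `P_k` is obtained from `P_{k-1}` by
internal insertion at the row of `U` containing `k`, while `Q_k` is obtained from `Q_{k-1}` by
placing `k` in the cell where this insertion terminates. -/
noncomputable def crsSeq (T U : Filling d L) : ℕ → Filling d L × Filling d L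
  | 0 => (T, empty T.outer)
  | k + 1 =>
    let P := (crsSeq T U k).1
    let Q := (crsSeq T U k).2
    let R := P.internalInsert (U.rowOf (k + 1))
    (R.1, Q.append R.2 (k + 1))

/-- The cylindric Robinson–Schensted algorithm, applied to tableaux with the same inner shape. -/
noncomputable def CRS (T U : Filling d L) : Filling d L × Filling d L :=
  crsSeq T U U.size

/-- The map `T ↦ P`, where `CRS T T = (P, P)`. -/
noncomputable def Phi (T : Filling d L) : Filling d L :=
  (CRS T T).1

end Filling

end Cylindric

namespace Cylindric

/-! A standard cylindric tableau is determined by its inner shape and its word, whose letter `k` is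
the row modulo `d` of the entry `k + 1`. In these terms internal insertion at row `r` is very
simple: a letter, initially `r`, travels through the word from left to right; whenever it meets a
letter equal to itself, both increase by `1`, and otherwise nothing changes. The rewritten word is
that of the new tableau, and the letter that leaves is the row in which the insertion terminates
(`internalInsert_reads`).

Hence `CRS` is a rectangular grid of local rules `(a, b) ↦ (bump a b, bump b a)`: the words of `T`
and `U` enter on two sides, those of `P` and `Q` leave on the opposite sides (`CRS_reads`). The rule
treats its two letters alike, so the grid may be transposed (`gridCarry_swap`), and the components
of `CRS T T` agree. The rule is also undone by itself after `x ↦ 1 - x` (`bump_reverse`), so the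
grid rotated by 180° with letters `1 - x` is again a grid (`grid_reverse`). Complementation reverses
a word and applies `x ↦ 1 - x` (`IsStandard.word_complement`), which is exactly this rotation.

Since `addCell` leaves a shape unchanged where no cell fits, it must also be shown that every cell
added along the way is addable; this is the growth diagram of shapes attached to the grid. -/

theorem sum_Icc_ite_intCast_eq {d : ℕ} (hd : 1 ≤ d) (x : ZMod d) :
    ∑ i ∈ Finset.Icc (1 : ℤ) d, (if (i : ZMod d) = x then (1 : ℤ) else 0) = 1 := by
  have : NeZero d := ⟨by omega⟩
  have hlt := ZMod.val_lt (x - 1)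
  have hx : ((((x - 1).val : ℤ) + 1 : ℤ) : ZMod d) = x := by
    push_cast
    rw [ZMod.natCast_zmod_val]; ring
  rw [Finset.sum_eq_single (((x - 1).val : ℤ) + 1)]
  · rw [if_pos hx]
  · intro b hb hne
    rw [Finset.mem_Icc] at hb
    rw [if_neg]
    intro h
    rw [← hx, ZMod.intCast_eq_intCast_iff_dvd_sub] at h
    obtain ⟨q, hq⟩ := h
    apply hne
    have hq0 : q = 0 := by
      have h1 : q < 1 := by
        by_contra! hc
        nlinarith
      have h2 : -1 < q := by
        by_contra! hc
        nlinarith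
      omega
    subst hq0
    omega
  · intro h
    exfalso; apply h
    rw [Finset.mem_Icc]
    omega

/-! ### The local rule and the grid of words -/

/-- The local rule for one letter `a` of a word meeting the letter `b` of another word. -/
def bump {d : ℕ} (a b : ZMod d) : ZMod d := if a = b then a + 1 else a

/-- Equal letters `a` leave as `a + 1`, turn into `-a`, and are bumped back to `1 - a`; distinct
letters stay distinct under `x ↦ 1 - x` and are never bumped. -/
theorem bump_reverse {d : ℕ} (a b : ZMod d) :
    bump (1 - bump a b) (1 - bump b a) = 1 - a := by
  unfold bump
  by_cases h : a = b
  · subst h; simp only [if_true]; ring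
  · have h' : b ≠ a := fun e => h e.symm
    have : (1 : ZMod d) - a ≠ 1 - b := fun e => h (sub_right_injective e)
    simp [h, h', this]

/-- The letter obtained from `x` when it has passed the first `k` letters of the word `w`. -/
def carry {d : ℕ} (w : ℕ → ZMod d) (x : ZMod d) : ℕ → ZMod d
  | 0 => x
  | k + 1 => bump (carry w x k) (w k)

/-- The word obtained from `w` when the letter `x` has passed through it. -/
def passWord {d : ℕ} (w : ℕ → ZMod d) (x : ZMod d) (k : ℕ) : ZMod d :=
  bump (w k) (carry w x k)

/-- The word obtained from `t` when the first `k` letters of `u` have passed through it. -/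
def gridWord {d : ℕ} (t u : ℕ → ZMod d) : ℕ → ℕ → ZMod d
  | 0 => t
  | k + 1 => passWord (gridWord t u k) (u k)

/-- The letter `k` of `u` after it has passed the first `n` letters of the word at its time. -/
def gridCarry {d : ℕ} (t u : ℕ → ZMod d) (n k : ℕ) : ZMod d :=
  carry (gridWord t u k) (u k) n

/-- The labels on two adjacent sides and the local rule force all others. Thus any labelling that
obeys the rule can be recognised as the grid, which gives both symmetries below. -/
theorem grid_unique {d : ℕ} {t u : ℕ → ZMod d} {n m : ℕ} (p q : ℕ → ℕ → ZMod d)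
    (hp0 : ∀ j < n, p j 0 = t j) (hq0 : ∀ k < m, q 0 k = u k)
    (hp : ∀ j < n, ∀ k < m, p j (k + 1) = bump (p j k) (q j k))
    (hq : ∀ j < n, ∀ k < m, q (j + 1) k = bump (q j k) (p j k)) :
    ∀ k ≤ m, (∀ j < n, gridWord t u k j = p j k) ∧
      (k < m → ∀ j ≤ n, gridCarry t u j k = q j k) := by
  have carry_eq : ∀ k, k < m → (∀ j < n, gridWord t u k j = p j k) →
      ∀ j ≤ n, gridCarry t u j k = q j k := by
    intro k hk h j
    induction j with
    | zero => intro _; exact (hq0 k hk).symm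
    | succ j ih =>
      intro hj
      rw [hq j hj k hk, ← ih (by omega), ← h j hj]
      rfl
  intro k
  induction k with
  | zero =>
    intro _
    have h : ∀ j < n, gridWord t u 0 j = p j 0 := fun j hj => (hp0 j hj).symm
    exact ⟨h, fun hk => carry_eq 0 hk h⟩
  | succ k ih =>
    intro hk
    obtain ⟨h1, h2⟩ := ih (by omega)
    have h : ∀ j < n, gridWord t u (k + 1) j = p j (k + 1) := by
      intro j hj
      rw [hp j hj k hk, ← h1 j hj, ← h2 hk j hj.le]
      rfl
    exact ⟨h, fun hk => carry_eq (k + 1) hk h⟩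

/-- The local rule is symmetric in its two letters, so the transposed labelling satisfies it as
well. -/
theorem gridCarry_swap {d : ℕ} (t u : ℕ → ZMod d) (j k : ℕ) :
    gridCarry t u j k = gridWord u t j k := by
  have := grid_unique (t := u) (u := t) (n := k + 1) (m := j) (fun k j => gridCarry t u j k)
    (fun k j => gridWord t u k j) (fun _ _ => rfl) (fun _ _ => rfl) (fun _ _ _ _ => rfl)
    (fun _ _ _ _ => rfl)
  exact ((this j le_rfl).1 k (by omega)).symm

theorem grid_reverse {d : ℕ} {t u t' u' : ℕ → ZMod d} {n m : ℕ}
    (ht : ∀ j < n, t' j = 1 - gridWord t u m (n - 1 - j))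
    (hu : ∀ k < m, u' k = 1 - gridCarry t u n (m - 1 - k)) :
    (∀ j < n, gridWord t' u' m j = 1 - t (n - 1 - j)) ∧
      ∀ k < m, gridCarry t' u' n k = 1 - u (m - 1 - k) := by
  have key := grid_unique (t := t') (u := u') (n := n) (m := m)
    -- The rotated grid. An index that numbers letters is reflected by `j ↦ n - 1 - j`, one that
    -- counts letters already passed by `k ↦ m - k`.
    (fun j k => 1 - gridWord t u (m - k) (n - 1 - j))
    (fun j k => 1 - gridCarry t u (n - j) (m - 1 - k))
    (fun j hj => by simpa using (ht j hj).symm) (fun k hk => by simpa using (hu k hk).symm)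
    (by
      intro j hj k hk
      obtain ⟨J, hJ⟩ : ∃ J, n - j = J + 1 := ⟨n - j - 1, by omega⟩
      obtain ⟨K, hK⟩ : ∃ K, m - k = K + 1 := ⟨m - k - 1, by omega⟩
      simp only [show n - 1 - j = J by omega, show m - 1 - k = K by omega,
        show m - (k + 1) = K by omega, hJ, hK]
      exact (bump_reverse _ _).symm)
    (by
      intro j hj k hk
      obtain ⟨J, hJ⟩ : ∃ J, n - j = J + 1 := ⟨n - j - 1, by omega⟩
      obtain ⟨K, hK⟩ : ∃ K, m - k = K + 1 := ⟨m - k - 1, by omega⟩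
      simp only [show n - 1 - j = J by omega, show m - 1 - k = K by omega,
        show n - (j + 1) = J by omega, hJ, hK]
      exact (bump_reverse _ _).symm)
  refine ⟨fun j hj => ?_, fun k hk => ?_⟩
  · rw [(key m le_rfl).1 j hj, Nat.sub_self]
    rfl
  · rw [(key k hk.le).2 hk n le_rfl, Nat.sub_self]
    rfl

/-! ### Words as chains of shapes: the growth diagram -/

/-- The row lengths obtained from `f` by adding the first `k` letters of `w` one after another. -/
def addWord {d : ℕ} (f : ℤ → ℤ) (w : ℕ → ZMod d) (k : ℕ) (i : ℤ) : ℤ :=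
  f i + Nat.count (fun j => w j = (i : ZMod d)) k

theorem addWord_succ {d : ℕ} (f : ℤ → ℤ) (w : ℕ → ZMod d) (k : ℕ) (i : ℤ) :
    addWord f w (k + 1) i = addWord f w k i + if (i : ZMod d) = w k then 1 else 0 := by
  unfold addWord
  rw [Nat.count_succ]
  by_cases h : w k = (i : ZMod d)
  · rw [if_pos h, if_pos h.symm]; push_cast; ring
  · rw [if_neg h, if_neg (fun e => h e.symm)]; simp

/-- A cell may be added to the rows congruent to `x`. -/
def Addable {d : ℕ} (f : ℤ → ℤ) (x : ZMod d) : Prop :=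
  ∀ i : ℤ, (i : ZMod d) = x → f i < f (i - 1)

/-- The first `n` letters of `w` may be added to `f` one after another. -/
def ValidWord {d : ℕ} (f : ℤ → ℤ) (w : ℕ → ZMod d) (n : ℕ) : Prop :=
  ∀ k < n, Addable (addWord f w k) (w k)

theorem intCast_sub_one_eq {d : ℕ} {i : ℤ} {x : ZMod d} (h : (i : ZMod d) = x + 1) :
    ((i - 1 : ℤ) : ZMod d) = x := by
  push_cast; rw [h]; ring

theorem ValidWord.antitone {d : ℕ} {f : ℤ → ℤ} {w : ℕ → ZMod d} {n : ℕ}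
    (hw : ValidWord f w n) (hf : ∀ i, f i ≤ f (i - 1)) :
    ∀ k ≤ n, ∀ i, addWord f w k i ≤ addWord f w k (i - 1) := by
  intro k
  induction k with
  | zero => intro _ i; simpa [addWord] using hf i
  | succ k ih =>
    intro hk i
    have h1 := ih (by omega) i
    have h2 := hw k hk i
    rw [addWord_succ, addWord_succ]
    by_cases h : (i : ZMod d) = w k
    · have := h2 h
      rw [if_pos h]; split_ifs <;> omega
    · rw [if_neg h]; split_ifs <;> omega

/-- One square of the growth diagram. -/
theorem Addable.bump {d : ℕ} {f g : ℤ → ℤ} {t x : ZMod d} (hf : ∀ i, f i ≤ f (i - 1))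
    (ht : Addable f t) (hx : Addable f x)
    (hg : ∀ i : ℤ, g i = f i + if (i : ZMod d) = t then 1 else 0) :
    Addable g (bump x t) := by
  intro i hi
  rw [hg, hg]
  unfold Cylindric.bump at hi
  by_cases h : x = t
  · rw [if_pos h] at hi
    have h1 := intCast_sub_one_eq hi
    rw [if_pos (h1.trans h)]
    -- Row `i - 1` has just grown, which makes room in row `i`. Row `i` has grown too only if `d =
    -- 1`; then the strict inequality provided by `ht` persists.
    by_cases h2 : (i : ZMod d) = t
    · have := ht i h2
      rw [if_pos h2]; omega
    · have := hf i
      rw [if_neg h2]; omega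
  · rw [if_neg h] at hi
    have h1 := hx i hi
    rw [if_neg (by rw [hi]; exact h)]
    split_ifs <;> omega

/-- A strip of squares: after `k` letters the two chains of shapes differ by one cell, and the
travelling letter names its row. This is how addability reaches the outer shape. -/
theorem ValidWord.carry {d : ℕ} {f g : ℤ → ℤ} {w : ℕ → ZMod d} {n : ℕ} {x : ZMod d}
    (hw : ValidWord f w n) (hf : ∀ i, f i ≤ f (i - 1)) (hx : Addable f x)
    (hg : ∀ i : ℤ, g i = f i + if (i : ZMod d) = x then 1 else 0) :
    ∀ k ≤ n, Addable (addWord f w k) (carry w x k) ∧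
      ∀ i : ℤ, addWord g (passWord w x) k i =
        addWord f w k i + if (i : ZMod d) = Cylindric.carry w x k then 1 else 0 := by
  intro k
  induction k with
  | zero =>
    intro _
    refine ⟨?_, fun i => ?_⟩
    · intro i hi
      simpa [addWord] using hx i hi
    · simp only [addWord, Nat.count_zero, Nat.cast_zero, add_zero]
      exact hg i
  | succ k ih =>
    intro hk
    obtain ⟨h1, h2⟩ := ih (by omega)
    refine ⟨Addable.bump (hw.antitone hf k (by omega)) (hw k hk) h1 (addWord_succ f w k), ?_⟩
    intro i
    rw [addWord_succ, addWord_succ, h2]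
    simp only [Cylindric.carry, passWord, Cylindric.bump]
    by_cases h : w k = Cylindric.carry w x k
    · simp [h]
    · have h' : Cylindric.carry w x k ≠ w k := fun e => h e.symm
      simp only [h, h', if_false]
      omega

theorem ValidWord.passWord {d : ℕ} {f g : ℤ → ℤ} {w : ℕ → ZMod d} {n : ℕ} {x : ZMod d}
    (hw : ValidWord f w n) (hf : ∀ i, f i ≤ f (i - 1)) (hx : Addable f x)
    (hg : ∀ i : ℤ, g i = f i + if (i : ZMod d) = x then 1 else 0) :
    ValidWord g (passWord w x) n := by
  intro k hk
  obtain ⟨h1, h2⟩ := hw.carry hf hx hg k hk.le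
  exact Addable.bump (hw.antitone hf k hk.le) h1 (hw k hk) h2

/-! ### Shapes and cells modulo the period -/

namespace Shape

variable {d L : ℕ}

theorem row_le_pred (lam : Shape d L) (i : ℤ) : lam.row i ≤ lam.row (i - 1) :=
  lam.antitone (by omega)

theorem row_add_mul (lam : Shape d L) (i z : ℤ) :
    lam.row (i + z * d) = lam.row i - z * L := by
  induction z using Int.induction_on with
  | zero => simp
  | succ z ih =>
    have h := lam.period (i + z * d)
    rw [show i + ((z : ℤ) + 1) * d = i + z * d + d by ring]
    linarith
  | pred z ih =>
    have h := lam.period (i + (-(z : ℤ) - 1) * d)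
    rw [show i + (-(z : ℤ) - 1) * d + d = i + -(z : ℤ) * d by ring, ih] at h
    linarith

theorem addable_iff (lam : Shape d L) (r : ℤ) :
    Addable lam.row (r : ZMod d) ↔ lam.row r < lam.row (r - 1) := by
  refine ⟨fun h => h r rfl, fun h i hi => lam.row_lt_of_dvd h ?_⟩
  rw [← ZMod.intCast_eq_intCast_iff_dvd_sub, hi]

theorem addCell_row {lam : Shape d L} {r : ℤ} (h : Addable lam.row (r : ZMod d)) (i : ℤ) :
    (lam.addCell r).row i = lam.row i + if (i : ZMod d) = (r : ZMod d) then 1 else 0 := by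
  have e : ((d : ℤ) ∣ i - r) ↔ (i : ZMod d) = (r : ZMod d) := by
    rw [eq_comm, ZMod.intCast_eq_intCast_iff_dvd_sub]
  unfold addCell
  rw [dif_pos ((addable_iff lam r).1 h)]
  simp only [e]
  split_ifs <;> simp

theorem complement_complement (lam : Shape d L) : lam.complement.complement = lam := by
  ext i
  simp [complement]

end Shape

theorem cell_eq_iff {d L : ℕ} {i j i' j' : ℤ} :
    cell d L i j = cell d L i' j' ↔ ∃ z : ℤ, i' = i + z * d ∧ j' = j - z * L := by
  unfold cell
  rw [QuotientAddGroup.eq, AddSubgroup.mem_zmultiples_iff]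
  constructor
  · rintro ⟨z, hz⟩
    simp only [Prod.ext_iff, Prod.smul_mk, smul_eq_mul, Prod.neg_mk, Prod.mk_add_mk] at hz
    exact ⟨-z, by linarith [hz.1], by linarith [hz.2]⟩
  · rintro ⟨z, rfl, rfl⟩
    refine ⟨-z, ?_⟩
    simp only [Prod.ext_iff, Prod.smul_mk, smul_eq_mul, Prod.neg_mk, Prod.mk_add_mk]
    constructor <;> ring

theorem exists_eq_cell {d L : ℕ} (c : Cell d L) : ∃ i j, c = cell d L i j := by
  obtain ⟨⟨i, j⟩, rfl⟩ := QuotientAddGroup.mk_surjective c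
  exact ⟨i, j, rfl⟩

theorem cell_row_congr {d L : ℕ} {i j i' j' : ℤ} (h : cell d L i j = cell d L i' j') :
    (i : ZMod d) = (i' : ZMod d) := by
  obtain ⟨z, rfl, -⟩ := cell_eq_iff.1 h
  simp

theorem exists_eq_add_mul {d : ℕ} {i i' : ℤ} (h : (i : ZMod d) = (i' : ZMod d)) :
    ∃ z : ℤ, i' = i + z * d := by
  rw [ZMod.intCast_eq_intCast_iff_dvd_sub] at h
  obtain ⟨z, hz⟩ := h
  exact ⟨z, by linarith⟩

/-- Being the cell in column `row i + e` of row `i`. -/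
theorem Shape.cell_row_eq_iff {d L : ℕ} (lam : Shape d L) {i j r e : ℤ} :
    cell d L i j = cell d L r (lam.row r + e) ↔
      (i : ZMod d) = (r : ZMod d) ∧ j = lam.row i + e := by
  constructor
  · intro h
    refine ⟨cell_row_congr h, ?_⟩
    obtain ⟨z, rfl, hj⟩ := cell_eq_iff.1 h
    rw [Shape.row_add_mul] at hj
    linarith
  · rintro ⟨h, rfl⟩
    obtain ⟨z, rfl⟩ := exists_eq_add_mul h
    rw [cell_eq_iff]
    exact ⟨z, rfl, by rw [Shape.row_add_mul]; ring⟩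

/-! ### Tableaux encoded by words -/

/-- The first `n` letters of `w`. -/
def prefixWord {d : ℕ} (n : ℕ) (w : ℕ → ZMod d) (k : ℕ) : Option (ZMod d) :=
  if k < n then some (w k) else none

theorem prefixWord_eq_some {d : ℕ} {n : ℕ} {w : ℕ → ZMod d} {k : ℕ} {x : ZMod d} :
    prefixWord n w k = some x ↔ k < n ∧ w k = x := by
  unfold prefixWord
  split_ifs with h <;> simp [h]

theorem prefixWord_congr {d : ℕ} {n : ℕ} {w w' : ℕ → ZMod d} (h : ∀ k < n, w k = w' k) :
    prefixWord n w = prefixWord n w' := by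
  funext k
  unfold prefixWord
  split_ifs with hk
  · rw [h k hk]
  · rfl

theorem count_congr_of_lt {p q : ℕ → Prop} [DecidablePred p] [DecidablePred q] {n : ℕ}
    (h : ∀ k < n, p k ↔ q k) : Nat.count p n = Nat.count q n := by
  rw [Nat.count_eq_card_filter_range, Nat.count_eq_card_filter_range]
  congr 1
  apply Finset.filter_congr
  intro k hk
  exact h k (Finset.mem_range.1 hk)

theorem addWord_eq {d : ℕ} (f : ℤ → ℤ) {n : ℕ} (w : ℕ → ZMod d) {k : ℕ} (hk : k ≤ n) (i : ℤ) :
    addWord f w k i = f i + Nat.count (fun j => prefixWord n w j = some (i : ZMod d)) k := by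
  unfold addWord
  congr 2
  apply count_congr_of_lt
  intro j hj
  rw [prefixWord_eq_some]
  exact ⟨fun h => ⟨by omega, h⟩, fun h => h.2⟩

namespace Filling

variable {d L : ℕ}

theorem mem_cells {T : Filling d L} {i j : ℤ} :
    cell d L i j ∈ T.cells ↔ T.inner.row i < j ∧ j ≤ T.outer.row i := by
  constructor
  · rintro ⟨i', j', h, h1, h2⟩
    obtain ⟨z, rfl, rfl⟩ := cell_eq_iff.1 h
    rw [Shape.row_add_mul] at h1 h2
    constructor <;> linarith
  · rintro ⟨h1, h2⟩
    exact ⟨i, j, rfl, h1, h2⟩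

/-- The entry `k + 1` is in row `w k`, and the entries of each row increase from left to right. -/
structure Reads (T : Filling d L) (w : ℕ → Option (ZMod d)) (n : ℕ) : Prop where
  entry : ∀ (i j : ℤ) (k : ℕ), T.entry (cell d L i j) = k + 1 ↔
    w k = some (i : ZMod d) ∧
      j = T.inner.row i + Nat.count (fun l => w l = some (i : ZMod d)) k + 1
  outer : ∀ i : ℤ, T.outer.row i =
    T.inner.row i + Nat.count (fun l => w l = some (i : ZMod d)) n
  eq_none : ∀ k, n ≤ k → w k = none

/-- Reduces equality of tableaux to equality of words and of inner shapes. -/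
theorem Reads.eq {T U : Filling d L} {w : ℕ → Option (ZMod d)} {n : ℕ} (hT : T.Reads w n)
    (hU : U.Reads w n) (h : T.inner = U.inner) : T = U := by
  apply Filling.ext h
  · ext i
    rw [hT.outer, hU.outer, h]
  · funext c
    obtain ⟨i, j, rfl⟩ := exists_eq_cell c
    have key : ∀ k, T.entry (cell d L i j) = k + 1 ↔ U.entry (cell d L i j) = k + 1 := by
      intro k
      rw [hT.entry, hU.entry, h]
    rcases hk : T.entry (cell d L i j) with _ | k
    · rcases hk' : U.entry (cell d L i j) with _ | k'
      · rfl
      · have := (key k').2 hk'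
        omega
    · exact ((key k).1 hk).symm

theorem Reads.exists_entry_iff {T : Filling d L} {w : ℕ → Option (ZMod d)} {n : ℕ}
    (hT : T.Reads w n) {i : ℤ} {k : ℕ} :
    (∃ j, T.entry (cell d L i j) = k + 1) ↔ w k = some (i : ZMod d) := by
  constructor
  · rintro ⟨j, hj⟩
    exact ((hT.entry i j k).1 hj).1
  · intro h
    exact ⟨_, (hT.entry i _ k).2 ⟨h, rfl⟩⟩

/-- Each letter contributes exactly one cell to the rows `1, …, d`. -/
theorem Reads.size_eq {T : Filling d L} {w : ℕ → ZMod d} {n : ℕ} (hd : 1 ≤ d)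
    (hT : T.Reads (prefixWord n w) n) : T.size = n := by
  have key : ∀ k, ∑ i ∈ Finset.Icc (1 : ℤ) d, addWord (fun _ => 0) w k i = k := by
    intro k
    induction k with
    | zero => simp [addWord]
    | succ k ih =>
      simp only [addWord_succ, Finset.sum_add_distrib, ih, sum_Icc_ite_intCast_eq hd]
      push_cast; rfl
  unfold size
  rw [Finset.sum_congr rfl (g := fun i => addWord (fun _ => 0) w n i), key, Int.toNat_natCast]
  intro i _
  rw [hT.outer, addWord_eq _ w le_rfl]
  ring

/-- The word of a tableau: its letter `k` is the row of the entry `k + 1`. -/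
noncomputable def word (T : Filling d L) (k : ℕ) : ZMod d := (T.rowOf (k + 1) : ZMod d)

theorem IsStandard.entry_pos {T : Filling d L} (hT : T.IsStandard) {c : Cell d L}
    (hc : c ∈ T.cells) : 1 ≤ T.entry c ∧ T.entry c ≤ T.size :=
  hT.bijOn.mapsTo hc

theorem IsStandard.mem_of_entry {T : Filling d L} (hT : T.IsStandard) {c : Cell d L} {k : ℕ}
    (h : T.entry c = k + 1) : c ∈ T.cells := by
  by_contra hc
  have := hT.entry_eq_zero c hc
  omega

theorem exists_row_rep (hd : 1 ≤ d) (i j : ℤ) :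
    ∃ i' j' : ℤ, 1 ≤ i' ∧ i' ≤ d ∧ cell d L i' j' = cell d L i j := by
  have h1 := Int.emod_add_mul_ediv (i - 1) d
  have h2 := Int.emod_nonneg (i - 1) (b := d) (by omega)
  have h3 := Int.emod_lt_of_pos (i - 1) (b := d) (by omega)
  refine ⟨(i - 1) % d + 1, j + (i - 1) / d * L, by omega, by omega,
    cell_eq_iff.2 ⟨(i - 1) / d, ?_, ?_⟩⟩
  · linarith
  · ring

theorem IsStandard.word_eq {T : Filling d L} (hd : 1 ≤ d) (hT : T.IsStandard) {i j : ℤ} {k : ℕ}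
    (h : T.entry (cell d L i j) = k + 1) : T.word k = (i : ZMod d) := by
  have hex : ∃ i' : ℤ, 1 ≤ i' ∧ i' ≤ d ∧ ∃ j' : ℤ, T.entry (cell d L i' j') = k + 1 := by
    obtain ⟨i', j', h1, h2, h3⟩ := exists_row_rep (L := L) hd i j
    exact ⟨i', h1, h2, j', by rw [h3, h]⟩
  unfold word rowOf
  rw [dif_pos hex]
  obtain ⟨-, -, j', hj'⟩ := hex.choose_spec
  exact cell_row_congr (hT.bijOn.injOn (hT.mem_of_entry hj') (hT.mem_of_entry h)
    (hj'.trans h.symm))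

theorem IsStandard.word_eq_iff {T : Filling d L} (hd : 1 ≤ d) (hT : T.IsStandard) {i : ℤ} {k : ℕ} :
    prefixWord T.size T.word k = some (i : ZMod d) ↔
      ∃ j, T.entry (cell d L i j) = k + 1 := by
  rw [prefixWord_eq_some]
  constructor
  · rintro ⟨hk, h⟩
    obtain ⟨c, hc, hck⟩ := hT.bijOn.surjOn (show k + 1 ∈ Set.Icc 1 T.size from ⟨by omega, hk⟩)
    obtain ⟨i', j', rfl⟩ := exists_eq_cell c
    have hi := hT.word_eq hd hck
    rw [h] at hi
    obtain ⟨z, rfl⟩ := exists_eq_add_mul hi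
    refine ⟨j' + z * L, ?_⟩
    rw [← hck, cell_eq_iff.2 ⟨z, rfl, by ring⟩]
  · rintro ⟨j, hj⟩
    refine ⟨?_, hT.word_eq hd hj⟩
    have := (hT.entry_pos (hT.mem_of_entry hj)).2
    omega

theorem IsStandard.row_strictMono {T : Filling d L} (hT : T.IsStandard) {i j j' : ℤ}
    (h1 : T.inner.row i < j) (h : j < j') (h2 : j' ≤ T.outer.row i) :
    T.entry (cell d L i j) < T.entry (cell d L i j') := by
  induction j', h using Int.leInduction with
  | base => exact hT.row_lt i j (mem_cells.2 ⟨h1, by omega⟩) (mem_cells.2 ⟨by omega, h2⟩)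
  | succ j' hj' ih =>
    exact (ih (by omega)).trans
      (hT.row_lt i j' (mem_cells.2 ⟨by omega, by omega⟩) (mem_cells.2 ⟨by omega, h2⟩))

/-- The hypothesis `h` says that the entries at most `k` of row `i` fill precisely the columns up to
`j`. It is applied with `j` the column of the entry `k`, and with `j` the end of the row. -/
theorem IsStandard.count_eq {T : Filling d L} (hd : 1 ≤ d) (hT : T.IsStandard) {i j : ℤ} {k : ℕ}
    (hj : T.inner.row i ≤ j)
    (h : ∀ j', (T.inner.row i < j' ∧ j' ≤ T.outer.row i) ∧ T.entry (cell d L i j') ≤ k ↔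
      T.inner.row i < j' ∧ j' ≤ j) :
    j = T.inner.row i +
      Nat.count (fun l => prefixWord T.size T.word l = some (i : ZMod d)) k := by
  have key : (Finset.Ioc (T.inner.row i) j).card =
      Nat.count (fun l => prefixWord T.size T.word l = some (i : ZMod d)) k := by
    rw [Nat.count_eq_card_filter_range]
    apply Finset.card_bij (fun j' _ => T.entry (cell d L i j') - 1)
    · intro j' hj'
      obtain ⟨h1, h2⟩ := (h j').2 (Finset.mem_Ioc.1 hj')
      have h3 := hT.entry_pos (mem_cells.2 h1)
      rw [Finset.mem_filter, Finset.mem_range, hT.word_eq_iff hd]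
      exact ⟨by omega, j', by omega⟩
    · intro a ha b hb hab
      obtain ⟨ha1, -⟩ := (h a).2 (Finset.mem_Ioc.1 ha)
      obtain ⟨hb1, -⟩ := (h b).2 (Finset.mem_Ioc.1 hb)
      have h3 := hT.entry_pos (mem_cells.2 ha1)
      have h4 := hT.entry_pos (mem_cells.2 hb1)
      rcases lt_trichotomy a b with hlt | heq | hlt
      · have := hT.row_strictMono ha1.1 hlt hb1.2
        omega
      · exact heq
      · have := hT.row_strictMono hb1.1 hlt ha1.2
        omega
    · intro l hl
      rw [Finset.mem_filter, Finset.mem_range, hT.word_eq_iff hd] at hl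
      obtain ⟨hlk, j', hj'⟩ := hl
      refine ⟨j', Finset.mem_Ioc.2 ((h j').1 ⟨mem_cells.1 (hT.mem_of_entry hj'), ?_⟩), by omega⟩
      omega
  rw [← key, Int.card_Ioc]
  omega

theorem IsStandard.column_eq {T : Filling d L} (hd : 1 ≤ d) (hT : T.IsStandard) {i j : ℤ} {k : ℕ}
    (h : T.entry (cell d L i j) = k + 1) :
    j = T.inner.row i +
      Nat.count (fun l => prefixWord T.size T.word l = some (i : ZMod d)) k + 1 := by
  have hc := mem_cells.1 (hT.mem_of_entry h)
  have := hT.count_eq hd (i := i) (j := j) (k := k + 1) hc.1.le (by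
    intro j'
    constructor
    · rintro ⟨h1, h2⟩
      refine ⟨h1.1, ?_⟩
      by_contra! hlt
      have := hT.row_strictMono hc.1 hlt h1.2
      omega
    · rintro ⟨h1, h2⟩
      refine ⟨⟨h1, by omega⟩, ?_⟩
      rcases h2.eq_or_lt with rfl | hlt
      · exact h.le
      · have := hT.row_strictMono h1 hlt hc.2
        omega)
  rw [Nat.count_succ, if_pos ((hT.word_eq_iff hd).2 ⟨j, h⟩)] at this
  push_cast at this
  linarith

theorem IsStandard.reads {T : Filling d L} (hd : 1 ≤ d) (hT : T.IsStandard) :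
    T.Reads (prefixWord T.size T.word) T.size where
  entry i j k := by
    constructor
    · intro h
      exact ⟨(hT.word_eq_iff hd).2 ⟨j, h⟩, hT.column_eq hd h⟩
    · rintro ⟨h1, h2⟩
      obtain ⟨j', hj'⟩ := (hT.word_eq_iff hd).1 h1
      rw [h2, ← hT.column_eq hd hj', hj']
  outer i := hT.count_eq hd (hT.inner_le_outer i) (by
    intro j'
    constructor
    · exact fun h => h.1
    · exact fun h => ⟨h, (hT.entry_pos (mem_cells.2 h)).2⟩)
  eq_none k hk := by
    unfold prefixWord
    rw [if_neg (by omega)]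

/-- This is the column condition. The cell above the entry `k + 1` either belongs to the inner shape
or holds a smaller entry, so it is present before that entry is added. -/
theorem IsStandard.validWord {T : Filling d L} (hd : 1 ≤ d) (hT : T.IsStandard) :
    ValidWord T.inner.row T.word T.size := by
  intro k hk i hi
  obtain ⟨j, hj⟩ := (hT.word_eq_iff hd).1 (prefixWord_eq_some.2 ⟨hk, hi.symm⟩)
  have hc := mem_cells.1 (hT.mem_of_entry hj)
  have hcol := hT.column_eq hd hj
  rw [addWord_eq _ _ hk.le, addWord_eq _ _ hk.le]
  by_cases h : j ≤ T.inner.row (i - 1)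
  · omega
  · have hc' : cell d L (i - 1) j ∈ T.cells :=
      mem_cells.2 ⟨by omega, hc.2.trans (T.outer.row_le_pred i)⟩
    have hlt := hT.col_lt (i - 1) j hc'
      (by rw [sub_add_cancel]; exact hT.mem_of_entry hj)
    rw [sub_add_cancel, hj] at hlt
    obtain ⟨l, hl⟩ : ∃ l, T.entry (cell d L (i - 1) j) = l + 1 :=
      ⟨_, (Nat.sub_add_cancel (hT.entry_pos hc').1).symm⟩
    have hcol' := hT.column_eq hd hl
    have hmem := (hT.word_eq_iff hd).2 ⟨j, hl⟩
    have hmono := Nat.count_monotone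
      (fun m => prefixWord T.size T.word m = some ((i - 1 : ℤ) : ZMod d))
      (show l + 1 ≤ k by omega)
    rw [Nat.count_succ, if_pos hmem] at hmono
    omega

end Filling

/-! ### Elementary changes of a filling, read on its word -/

theorem carry_eq_of_ne {d : ℕ} {w : ℕ → ZMod d} {x y : ZMod d} {a : ℕ} (ha : carry w x a = y)
    {k : ℕ} (hk : a ≤ k) (h : ∀ l, a ≤ l → l < k → w l ≠ y) : carry w x k = y := by
  induction k, hk using Nat.le_induction with
  | base => exact ha
  | succ k hk ih =>
    have h1 := ih fun l h1 h2 => h l h1 (by omega)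
    rw [carry, h1, bump, if_neg (fun e => h k hk (by omega) e.symm)]

theorem passWord_eq_of_ne {d : ℕ} {w : ℕ → ZMod d} {x : ZMod d} {k : ℕ}
    (h : w k ≠ carry w x k) : passWord w x k = w k := by
  rw [passWord, bump, if_neg h]

theorem count_update {α : Type*} [DecidableEq α] (w : ℕ → Option α) {a : ℕ} (x y : α)
    (ha : w a = none) (k : ℕ) :
    Nat.count (fun l => Function.update w a (some x) l = some y) k =
      Nat.count (fun l => w l = some y) k + if a < k ∧ x = y then 1 else 0 := by
  induction k with
  | zero => simp
  | succ k ih =>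
    rw [Nat.count_succ, Nat.count_succ, ih]
    rcases lt_trichotomy a k with h | h | h
    · rw [Function.update_of_ne h.ne']
      simp only [h, h.trans (Nat.lt_succ_self k), true_and]
      omega
    · subst h
      simp [ha]
    · rw [Function.update_of_ne h.ne]
      simp only [h.not_gt, show ¬ a < k + 1 by omega, false_and, if_false]
      omega

theorem count_eq_of_ne {p : ℕ → Prop} [DecidablePred p] {a k : ℕ} (h : a ≤ k)
    (hp : ∀ l, a ≤ l → l < k → ¬ p l) : Nat.count p k = Nat.count p a := by
  induction k, h using Nat.le_induction with
  | base => rfl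
  | succ k hk ih =>
    rw [Nat.count_succ, if_neg (hp k hk (by omega)), ih fun l h1 h2 => hp l h1 (by omega)]
    rfl

theorem count_lt_count {p : ℕ → Prop} [DecidablePred p] {a k : ℕ} (h : a < k) (ha : p a) :
    Nat.count p a < Nat.count p k := by
  have := Nat.count_monotone p (show a + 1 ≤ k from h)
  rw [Nat.count_succ, if_pos ha] at this
  omega

namespace Filling

variable {d L : ℕ} {T : Filling d L} {w : ℕ → Option (ZMod d)} {n : ℕ}

theorem Reads.lt (hT : T.Reads w n) {k : ℕ} {x : ZMod d} (h : w k = some x) : k < n := by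
  by_contra! hk
  rw [hT.eq_none k hk] at h
  cases h

/-- The inner shape gains a cell in row `r` while every later entry of that row loses one
predecessor, so the remaining entries keep their columns. -/
theorem Reads.update_none (hT : T.Reads w n) {r : ℤ} {a : ℕ}
    (hadd : Addable T.inner.row (r : ZMod d))
    (ha : T.entry (cell d L r (T.inner.row r + 1)) = a + 1) :
    Reads
      { inner := T.inner.addCell r, outer := T.outer,
        entry := Function.update T.entry (cell d L r (T.inner.row r + 1)) 0 }
      (Function.update w a none) n := by
  obtain ⟨hwa, hcount⟩ := (hT.entry _ _ _).1 ha
  -- The removed cell is the first of its row, so no earlier letter equals `r`.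
  replace hcount : Nat.count (fun l => w l = some (r : ZMod d)) a = 0 := by omega
  have hw : w = Function.update (Function.update w a none) a (some (r : ZMod d)) := by
    simp [← hwa]
  have hc : ∀ (i : ℤ) k, Nat.count (fun l => w l = some (i : ZMod d)) k =
      Nat.count (fun l => Function.update w a none l = some (i : ZMod d)) k +
        if a < k ∧ (r : ZMod d) = i then 1 else 0 := by
    intro i k
    conv_lhs => rw [hw]
    exact count_update _ _ _ (by simp) k
  refine ⟨fun i j k => ?_, fun i => ?_, fun k hk => ?_⟩
  · simp only [Shape.addCell_row hadd]
    by_cases hcell : cell d L i j = cell d L r (T.inner.row r + 1)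
    · rw [hcell, Function.update_self]
      obtain ⟨hi, hj⟩ := T.inner.cell_row_eq_iff.1 hcell
      rw [if_pos hi]
      constructor
      · intro h; omega
      · rintro ⟨-, h⟩; omega
    · rw [Function.update_of_ne hcell, hT.entry]
      by_cases hk : k = a
      · subst hk
        simp only [Function.update_self, reduceCtorEq, false_and, iff_false, not_and]
        intro h1 h2
        apply hcell
        rw [h1] at hwa
        have hi : (i : ZMod d) = r := Option.some_injective _ hwa
        rw [T.inner.cell_row_eq_iff]
        refine ⟨hi, ?_⟩
        rw [h2, hi, hcount]; simp
      · rw [Function.update_of_ne hk, and_congr_right_iff]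
        intro h
        rw [hc i k]
        by_cases hi : (i : ZMod d) = r
        · have hak : a < k := by
            by_contra! hka
            rw [hi] at h
            have := count_lt_count (p := fun l => w l = some (r : ZMod d))
              (lt_of_le_of_ne hka hk) h
            omega
          rw [if_pos ⟨hak, hi.symm⟩, if_pos hi]
          push_cast
          constructor <;> intro h <;> linarith
        · rw [if_neg (fun e => hi e.2.symm), if_neg hi]
          simp
  · simp only [Shape.addCell_row hadd]
    rw [hT.outer, hc i n]
    have := hT.lt hwa
    by_cases hi : (i : ZMod d) = r
    · rw [if_pos ⟨this, hi.symm⟩, if_pos hi]; push_cast; ring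
    · rw [if_neg (fun e => hi e.2.symm), if_neg hi]; simp
  · have := hT.lt hwa
    rw [Function.update_of_ne (by omega)]
    exact hT.eq_none k hk

theorem Reads.addCell_both (hT : T.Reads w n) {r : ℤ}
    (hi : Addable T.inner.row (r : ZMod d)) (ho : Addable T.outer.row (r : ZMod d))
    (h : ∀ k, w k ≠ some (r : ZMod d)) :
    Reads { inner := T.inner.addCell r, outer := T.outer.addCell r, entry := T.entry } w n := by
  refine ⟨fun i j k => ?_, fun i => ?_, hT.eq_none⟩
  · simp only [Shape.addCell_row hi, hT.entry, and_congr_right_iff]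
    intro hk
    rw [if_neg, add_zero]
    intro hir
    exact h k (hir ▸ hk)
  · simp only [Shape.addCell_row hi, Shape.addCell_row ho, hT.outer]
    ring

/-- The first letter equal to `r` would put its entry into the first cell of row `r`. -/
theorem Reads.ne_some_of_entry_eq_zero (hT : T.Reads w n) {r : ℤ}
    (h0 : T.entry (cell d L r (T.inner.row r + 1)) = 0) (k : ℕ) : w k ≠ some (r : ZMod d) := by
  induction k using Nat.strong_induction_on with
  | _ k ih =>
    intro hk
    have h1 := (hT.entry r _ k).2 ⟨hk, rfl⟩
    rw [count_eq_of_ne (Nat.zero_le k) fun l _ hl => ih l hl] at h1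
    simp [h0] at h1

theorem Reads.append (hT : T.Reads w n) {r : ℤ} {a : ℕ} (han : a < n) (ha : w a = none)
    (hlt : ∀ l, a < l → w l ≠ some (r : ZMod d)) (hadd : Addable T.outer.row (r : ZMod d)) :
    (T.append r (a + 1)).Reads (Function.update w a (some (r : ZMod d))) n := by
  have hc := fun (i : ℤ) => count_update w (r : ZMod d) (i : ZMod d) ha
  have hn : Nat.count (fun l => w l = some (r : ZMod d)) n =
      Nat.count (fun l => w l = some (r : ZMod d)) a := by
    apply count_eq_of_ne han.le
    intro l h1 _
    rcases h1.eq_or_lt with rfl | h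
    · rw [ha]; simp
    · exact hlt l h
  refine ⟨fun i j k => ?_, fun i => ?_, fun k hk => ?_⟩
  · simp only [Filling.append]
    by_cases hcell : cell d L i j = cell d L r (T.outer.row r + 1)
    · rw [hcell, Function.update_self]
      obtain ⟨hi, hj⟩ := T.outer.cell_row_eq_iff.1 hcell
      rw [hj, hT.outer, hc, hi, hn]
      by_cases hk : k = a
      · subst hk; simp
      · rw [Function.update_of_ne hk]
        constructor
        · intro h; omega
        · rintro ⟨h1, h2⟩
          have hka : k < a := by
            by_contra! h
            exact hlt k (by omega) h1
          have := count_lt_count (p := fun l => w l = some (r : ZMod d)) hka h1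
          rw [if_neg (by omega)] at h2
          omega
    · rw [Function.update_of_ne hcell, hT.entry, hc]
      by_cases hk : k = a
      · subst hk
        simp only [ha, reduceCtorEq, false_and, Function.update_self, lt_irrefl, if_false,
          Option.some.injEq, false_iff, not_and]
        intro hi hj
        apply hcell
        rw [T.outer.cell_row_eq_iff, hT.outer]
        refine ⟨hi.symm, ?_⟩
        rw [← hi, hn, hi, hj, ← hi]; simp
      · rw [Function.update_of_ne hk, and_congr_right_iff]
        intro h
        rw [if_neg]
        · simp
        · rintro ⟨h1, h2⟩
          exact hlt k h1 (h2 ▸ h)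
  · simp only [Filling.append, Shape.addCell_row hadd, hT.outer, hc]
    by_cases hi : (i : ZMod d) = r
    · rw [if_pos hi, if_pos ⟨han, hi.symm⟩]; push_cast; ring
    · rw [if_neg hi, if_neg (fun e => hi e.2.symm)]; simp
  · rw [Function.update_of_ne (by omega)]
    exact hT.eq_none k hk

/-- The letter `x` moves from position `b` to the hole at `a`. No letter strictly between equals
`x`, so no remaining entry changes column. -/
theorem Reads.replaceEntry (hT : T.Reads w n) {x : ZMod d} {a b : ℕ} (hab : a < b)
    (ha : w a = none) (hb : w b = some x) (hlt : ∀ l, a < l → l < b → w l ≠ some x) :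
    (T.replaceEntry (b + 1) (a + 1)).Reads
      (Function.update (Function.update w a (some x)) b none) n := by
  set w' := Function.update (Function.update w a (some x)) b none with hw'
  -- Restoring `x` at `b` in `w'` gives the same word as filling the hole `a` of `w`.
  have hc : ∀ (y : ZMod d) k, Nat.count (fun l => w' l = some y) k + (if b < k ∧ x = y then 1 else 0)
      = Nat.count (fun l => w l = some y) k + if a < k ∧ x = y then 1 else 0 := by
    intro y k
    rw [← count_update w x y ha, ← count_update w' x y (by simp [hw'])]
    congr 2
    funext l
    by_cases hl : l = b
    · subst hl; simp [hab.ne', hb]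
    · simp [hw', hl]
  have hcab : Nat.count (fun l => w l = some x) b = Nat.count (fun l => w l = some x) a := by
    apply count_eq_of_ne hab.le
    intro l h1 h2
    rcases h1.eq_or_lt with rfl | h
    · rw [ha]; simp
    · exact hlt l h h2
  have hbn := hT.lt hb
  refine ⟨fun i j k => ?_, fun i => ?_, fun k hk => ?_⟩
  · simp only [Filling.replaceEntry]
    have hna : T.entry (cell d L i j) ≠ a + 1 := by
      intro h
      have := ((hT.entry i j a).1 h).1
      rw [ha] at this
      cases this
    have hk := hc (i : ZMod d) k
    by_cases hka : k = a
    · subst hka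
      have e : (if T.entry (cell d L i j) = b + 1 then k + 1 else T.entry (cell d L i j)) = k + 1 ↔
          T.entry (cell d L i j) = b + 1 := by
        split_ifs with h <;> simp [h, hna]
      have hw'k : w' k = some x := by simp [hw', hab.ne]
      rw [e, hT.entry, hb, hw'k, and_congr_right_iff]
      intro hx
      rw [← Option.some_injective _ hx] at hk ⊢
      rw [if_neg (by omega), if_neg (by omega)] at hk
      omega
    · by_cases hkb : k = b
      · subst hkb
        have hw'k : w' k = none := by simp [hw']
        simp only [hw'k, reduceCtorEq, false_and, iff_false]
        split_ifs with h
        · omega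
        · exact h
      · have e : (if T.entry (cell d L i j) = b + 1 then a + 1 else T.entry (cell d L i j)) = k + 1 ↔
            T.entry (cell d L i j) = k + 1 := by
          split_ifs with h
          · omega
          · rfl
        have hw'k : w' k = w k := by simp [hw', hka, hkb]
        rw [e, hT.entry, hw'k, and_congr_right_iff]
        intro h
        by_cases hx : x = (i : ZMod d)
        · have hk' : a < k ↔ b < k := by
            refine ⟨fun h1 => ?_, fun h1 => by omega⟩
            by_contra! h2
            exact hlt k h1 (by omega) (hx ▸ h)
          simp only [hk'] at hk
          omega
        · simp only [hx, and_false, if_false] at hk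
          omega
  · simp only [Filling.replaceEntry]
    rw [hT.outer]
    have hk := hc (i : ZMod d) n
    simp only [hbn, hab.trans hbn, true_and] at hk
    omega
  · rw [hw', Function.update_of_ne (by omega), Function.update_of_ne (by omega)]
    exact hT.eq_none k hk

/-! ### Insertion as a letter travelling through a word -/

/-- The word of the filling from which the entry `a + 1` has just been removed, in the course of
the insertion of `x`. -/
def partialWord {d : ℕ} (w : ℕ → ZMod d) (x : ZMod d) (n a k : ℕ) : Option (ZMod d) :=
  if k = a then none else if k < a then some (passWord w x k) else prefixWord n w k

/-- With `a + 1` in transit, the word is rewritten before position `a`, has a hole at `a`, and is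
untouched after it. The invariant is that the row `r` about to receive `a + 1` is both the new
letter at `a` and the travelling letter just after `a`. The entry bumped next is then at the next
position whose letter equals the travelling letter. -/
theorem rowInsert_reads {v : ℕ → ZMod d} {x : ZMod d} {a : ℕ} {r : ℤ}
    (hT : T.Reads (partialWord v x n a) n) (han : a < n) (hcarry : carry v x (a + 1) = r)
    (hpass : passWord v x a = r) (hadd : Addable T.outer.row (carry v x n)) :
    (rowInsert n T r (a + 1)).1.Reads (prefixWord n (passWord v x)) n ∧
      (rowInsert n T r (a + 1)).1.inner = T.inner ∧
      ((rowInsert n T r (a + 1)).2 : ZMod d) = carry v x n ∧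
      (rowInsert n T r (a + 1)).1.outer = T.outer.addCell (rowInsert n T r (a + 1)).2 := by
  induction hm : n - a using Nat.strong_induction_on generalizing a r T with
  | _ m ih =>
    have hmem : ∀ b, b + 1 ∈ T.largerEntries n r (a + 1) ↔ a < b ∧ b < n ∧ v b = r := by
      intro b
      simp only [largerEntries, Set.mem_ofPred_eq, hT.exists_entry_iff, partialWord]
      constructor
      · rintro ⟨h1, h2, h3⟩
        rw [if_neg (by omega), if_neg (by omega), prefixWord_eq_some] at h3
        exact ⟨by omega, h3⟩
      · rintro ⟨h1, h2⟩
        rw [if_neg (by omega), if_neg (by omega), prefixWord_eq_some]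
        exact ⟨by omega, by omega, h2⟩
    rw [rowInsert]
    split_ifs with hne
    · have hinf := Nat.sInf_mem hne
      obtain ⟨b, hb⟩ : ∃ b, sInf (T.largerEntries n r (a + 1)) = b + 1 :=
        ⟨_, (Nat.sub_add_cancel (by have := hinf.1; omega)).symm⟩
      have hmin : ∀ l, a < l → l < b → v l ≠ r := by
        intro l h1 h2 h3
        have : l + 1 ∉ T.largerEntries n r (a + 1) := Nat.notMem_of_lt_sInf (by omega)
        apply this
        rw [hmem]
        have := hinf.2.1
        exact ⟨h1, by omega, h3⟩
      rw [hb, hmem] at hinf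
      obtain ⟨hab, hbn, hvb⟩ := hinf
      rw [hb]
      have hcb : carry v x b = r :=
        carry_eq_of_ne hcarry hab fun l h1 h2 => hmin l (by omega) h2
      have hrep := hT.replaceEntry (x := (r : ZMod d)) hab (by simp [partialWord])
        (by rw [partialWord, if_neg (by omega), if_neg (by omega), prefixWord_eq_some]
            exact ⟨hbn, hvb⟩)
        (by
          intro l h1 h2
          rw [partialWord, if_neg (by omega), if_neg (by omega), ne_eq, prefixWord_eq_some]
          exact fun h => hmin l h1 h2 h.2)
      have hword : Function.update (Function.update (partialWord v x n a) a (some (r : ZMod d))) b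
          none = partialWord v x n b := by
        funext k
        by_cases hkb : k = b
        · subst hkb; simp [partialWord]
        rw [Function.update_of_ne hkb]
        by_cases hka : k = a
        · subst hka; simp [partialWord, hkb, hab, hpass]
        rw [Function.update_of_ne hka]
        unfold partialWord
        rw [if_neg hka, if_neg hkb]
        rcases lt_or_ge k a with h | h
        · rw [if_pos h, if_pos (by omega)]
        · rw [if_neg (by omega)]
          rcases lt_or_ge k b with h' | h'
          · have hck : carry v x k = r :=
              carry_eq_of_ne hcarry (by omega) fun l h1 h2 => hmin l (by omega) (by omega)
            rw [if_pos h', passWord_eq_of_ne, prefixWord, if_pos (by omega)]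
            rw [hck]
            exact hmin k (by omega) h'
          · rw [if_neg (by omega)]
      rw [hword] at hrep
      exact ih (n - b) (by omega) hrep hbn
        -- At `b` the travelling letter meets its equal; both become `r + 1`, which restores the
        -- invariant for row `r + 1`.
        (by rw [carry, hcb, hvb, bump, if_pos rfl]; push_cast; rfl)
        (by rw [passWord, hcb, hvb, bump, if_pos rfl]; push_cast; rfl) hadd rfl
    -- No entry of row `r` is larger, so the travelling letter leaves the word as `r`, the row of
    -- the new cell.
    · have hmin : ∀ l, a < l → l < n → v l ≠ r := by
        intro l h1 h2 h3
        exact hne ⟨l + 1, (hmem l).2 ⟨h1, h2, h3⟩⟩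
      have hcn : carry v x n = r :=
        carry_eq_of_ne hcarry han fun l h1 h2 => hmin l (by omega) h2
      have happ := hT.append (r := r) han (by simp [partialWord])
        (by
          intro l h1
          rw [partialWord, if_neg (by omega), if_neg (by omega), ne_eq, prefixWord_eq_some]
          exact fun h => hmin l h1 h.1 h.2)
        (hcn ▸ hadd)
      have hword : Function.update (partialWord v x n a) a (some (r : ZMod d)) =
          prefixWord n (passWord v x) := by
        funext k
        by_cases hka : k = a
        · subst hka; simp [prefixWord, han, hpass]
        rw [Function.update_of_ne hka]
        unfold partialWord prefixWord
        rw [if_neg hka]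
        rcases lt_or_ge k a with h | h
        · rw [if_pos h, if_pos (by omega)]
        · rw [if_neg (by omega)]
          split_ifs with h'
          · have hck : carry v x k = r :=
              carry_eq_of_ne hcarry (by omega) fun l h1 h2 => hmin l (by omega) (by omega)
            rw [passWord_eq_of_ne]
            rw [hck]
            exact hmin k (by omega) h'
          · rfl
      rw [hword] at happ
      exact ⟨happ, rfl, hcn.symm, rfl⟩

/-- Internal insertion passes a letter through the word of a tableau. -/
theorem internalInsert_reads {v : ℕ → ZMod d} {r : ℤ} (hd : 1 ≤ d)
    (hT : T.Reads (prefixWord n v) n) (hv : ValidWord T.inner.row v n)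
    (hr : Addable T.inner.row (r : ZMod d)) :
    (T.internalInsert r).1.Reads (prefixWord n (passWord v r)) n ∧
      (T.internalInsert r).1.inner = T.inner.addCell r ∧
      ((T.internalInsert r).2 : ZMod d) = carry v r n ∧
      Addable T.outer.row (carry v r n) ∧
      (T.internalInsert r).1.outer = T.outer.addCell (T.internalInsert r).2 := by
  have hout : Addable T.outer.row (carry v r n) := by
    have h := (hv.carry T.inner.row_le_pred hr (fun _ => rfl) n le_rfl).1
    intro i hi
    have := h i hi
    rw [addWord_eq _ _ le_rfl, addWord_eq _ _ le_rfl] at this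
    rwa [hT.outer, hT.outer]
  have hsize := hT.size_eq hd
  unfold internalInsert
  simp only [hsize]
  split_ifs with h0
  -- Row `r` is empty: the letter meets no equal and passes through without changing anything.
  · have hne := hT.ne_some_of_entry_eq_zero h0
    have hne' : ∀ l, l < n → v l ≠ r := fun l hl h => hne l (prefixWord_eq_some.2 ⟨hl, h⟩)
    have hck : ∀ k ≤ n, carry v r k = (r : ZMod d) := fun k hk =>
      carry_eq_of_ne rfl (Nat.zero_le k) fun l _ hl => hne' l (by omega)
    have hcn := hck n le_rfl
    have hword : prefixWord n (passWord v r) = prefixWord n v := by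
      apply prefixWord_congr
      intro k hk
      exact passWord_eq_of_ne (by rw [hck k hk.le]; exact hne' k hk)
    rw [hword]
    exact ⟨hT.addCell_both hr (hcn ▸ hout) hne, rfl, hcn.symm, hout, rfl⟩
  · obtain ⟨a, ha⟩ : ∃ a, T.entry (cell d L r (T.inner.row r + 1)) = a + 1 :=
      ⟨_, (Nat.sub_add_cancel (Nat.one_le_iff_ne_zero.2 h0)).symm⟩
    rw [ha]
    have hrem := hT.update_none hr ha
    obtain ⟨hwa, hcount⟩ := (hT.entry _ _ _).1 ha
    replace hcount :
      Nat.count (fun l => prefixWord n v l = some (r : ZMod d)) a = 0 := by omega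
    obtain ⟨han, hva⟩ := prefixWord_eq_some.1 hwa
    -- Position `a` is the first one with letter `r`, so the travelling letter arrives there
    -- unchanged.
    have hne' : ∀ l, l < a → v l ≠ r := by
      intro l hl h
      have := count_lt_count (p := fun l => prefixWord n v l = some (r : ZMod d)) hl
        (prefixWord_eq_some.2 ⟨by omega, h⟩)
      omega
    have hck : ∀ k ≤ a, carry v r k = (r : ZMod d) := fun k hk =>
      carry_eq_of_ne rfl (Nat.zero_le k) fun l _ hl => hne' l (by omega)
    have hword : Function.update (prefixWord n v) a none = partialWord v r n a := by
      funext k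
      by_cases hka : k = a
      · subst hka; simp [partialWord]
      rw [Function.update_of_ne hka, partialWord, if_neg hka]
      split_ifs with h
      · rw [passWord_eq_of_ne (by rw [hck k h.le]; exact hne' k h), prefixWord,
          if_pos (by omega)]
      · rfl
    rw [hword] at hrem
    obtain ⟨h1, h2, h3, h4⟩ := rowInsert_reads (r := r + 1) hrem han
      (by rw [carry, hck a le_rfl, hva, bump, if_pos rfl]; push_cast; rfl)
      (by rw [passWord, hck a le_rfl, hva, bump, if_pos rfl]; push_cast; rfl) hout
    exact ⟨h1, h2, h3, hout, h4⟩

end Filling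

/-! ### Complements -/

theorem Cell.rotate_rotate {d L : ℕ} (c : Cell d L) : c.rotate.rotate = c := by
  simp [Cell.rotate]

namespace Filling

variable {d L : ℕ}

theorem mem_complement_cells {T : Filling d L} {c : Cell d L} :
    c ∈ T.complement.cells ↔ c.rotate ∈ T.cells := by
  obtain ⟨i, j, rfl⟩ := exists_eq_cell c
  rw [Cell.rotate_cell, mem_cells, mem_cells]
  simp only [complement, Shape.complement]
  constructor <;> rintro ⟨h1, h2⟩ <;> constructor <;> omega

theorem size_complement (T : Filling d L) : T.complement.size = T.size := by
  unfold size
  congr 1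
  apply Finset.sum_nbij' (fun i => (d : ℤ) + 1 - i) (fun i => (d : ℤ) + 1 - i)
  · intro i hi; rw [Finset.mem_Icc] at hi ⊢; omega
  · intro i hi; rw [Finset.mem_Icc] at hi ⊢; omega
  · intro i _; ring
  · intro i _; ring
  · intro i _; simp only [complement, Shape.complement]; ring

theorem complement_entry {T : Filling d L} {c : Cell d L} (hc : c.rotate ∈ T.cells) :
    T.complement.entry c = T.size + 1 - T.entry c.rotate := by
  simp only [complement, if_pos hc]

theorem IsStandard.complement {T : Filling d L} (hT : T.IsStandard) : T.complement.IsStandard where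
  inner_le_outer i := by
    have := hT.inner_le_outer (d + 1 - i)
    simp only [Filling.complement, Shape.complement]
    omega
  entry_eq_zero c hc := by
    rw [mem_complement_cells] at hc
    simp only [Filling.complement, if_neg hc]
  bijOn := by
    rw [size_complement]
    refine ⟨fun c hc => ?_, fun c hc c' hc' h => ?_, fun k hk => ?_⟩
    · rw [mem_complement_cells] at hc
      have := hT.entry_pos hc
      rw [complement_entry hc, Set.mem_Icc]
      omega
    · rw [mem_complement_cells] at hc hc'
      have h1 := hT.entry_pos hc
      have h2 := hT.entry_pos hc'
      rw [complement_entry hc, complement_entry hc'] at h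
      have := hT.bijOn.injOn hc hc' (by omega)
      rw [← c.rotate_rotate, this, c'.rotate_rotate]
    · rw [Set.mem_Icc] at hk
      obtain ⟨c, hc, hck⟩ := hT.bijOn.surjOn
        (show T.size + 1 - k ∈ Set.Icc 1 T.size from ⟨by omega, by omega⟩)
      have hc' : c.rotate.rotate ∈ T.cells := by rwa [c.rotate_rotate]
      refine ⟨c.rotate, mem_complement_cells.2 hc', ?_⟩
      rw [complement_entry hc', c.rotate_rotate, hck]
      omega
  row_lt i j h1 h2 := by
    rw [mem_complement_cells] at h1 h2
    rw [complement_entry h1, complement_entry h2]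
    rw [Cell.rotate_cell] at h1 h2 ⊢
    rw [Cell.rotate_cell]
    have h3 := hT.entry_pos h1
    have e : (L : ℤ) + 1 - j = L + 1 - (j + 1) + 1 := by ring
    rw [e] at h1 h3 ⊢
    have := hT.row_lt _ _ h2 h1
    omega
  col_lt i j h1 h2 := by
    rw [mem_complement_cells] at h1 h2
    rw [complement_entry h1, complement_entry h2]
    rw [Cell.rotate_cell] at h1 h2 ⊢
    rw [Cell.rotate_cell]
    have h3 := hT.entry_pos h1
    have e : (d : ℤ) + 1 - i = d + 1 - (i + 1) + 1 := by ring
    rw [e] at h1 h3 ⊢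
    have := hT.col_lt _ _ h2 h1
    omega

theorem IsStandard.complement_complement {T : Filling d L} (hT : T.IsStandard) :
    T.complement.complement = T := by
  apply Filling.ext
  · exact T.inner.complement_complement
  · exact T.outer.complement_complement
  · funext c
    by_cases hc : c ∈ T.cells
    · have h1 : c.rotate.rotate ∈ T.cells := by rwa [c.rotate_rotate]
      rw [complement_entry (mem_complement_cells.2 h1), complement_entry h1, size_complement,
        c.rotate_rotate]
      have := hT.entry_pos hc
      omega
    · rw [hT.entry_eq_zero c hc, hT.complement.complement.entry_eq_zero]
      rwa [mem_complement_cells, mem_complement_cells, c.rotate_rotate]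

/-- Entries are reversed, and row `i` becomes row `d + 1 - i`, which is `1 - i` modulo `d`. -/
theorem IsStandard.word_complement {T : Filling d L} (hd : 1 ≤ d) (hT : T.IsStandard) {k : ℕ}
    (hk : k < T.size) : T.complement.word k = 1 - T.word (T.size - 1 - k) := by
  obtain ⟨c, hc, hck⟩ := hT.bijOn.surjOn
    (show T.size - 1 - k + 1 ∈ Set.Icc 1 T.size from ⟨by omega, by omega⟩)
  obtain ⟨i, j, rfl⟩ := exists_eq_cell c
  have hc' : (cell d L (d + 1 - i) (L + 1 - j)).rotate = cell d L i j := by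
    rw [Cell.rotate_cell]; congr 1 <;> ring
  rw [hT.word_eq hd hck, hT.complement.word_eq hd (i := d + 1 - i) (j := L + 1 - j)]
  · push_cast; simp
  · rw [complement_entry (by rwa [hc']), hc', hck]
    omega

theorem IsStandard.word_eq_of_reads {T : Filling d L} (hd : 1 ≤ d) (hT : T.IsStandard)
    {w : ℕ → ZMod d} {n : ℕ} (h : T.Reads (prefixWord n w) n) {k : ℕ} (hk : k < n) :
    T.word k = w k := by
  obtain ⟨i, hi⟩ := ZMod.intCast_surjective (w k)
  obtain ⟨j, hj⟩ := h.exists_entry_iff.2 (prefixWord_eq_some.2 ⟨hk, hi.symm⟩)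
  rw [hT.word_eq hd hj, hi]

/-! ### The algorithm as a grid, and its symmetries -/

theorem reads_empty (lam : Shape d L) (w : ℕ → ZMod d) (n : ℕ) :
    (empty lam).Reads (prefixWord 0 w) n where
  entry i j k := by simp [empty, prefixWord]
  outer i := by simp [empty, prefixWord]
  eq_none k _ := by simp [prefixWord]

/-- The letters of `U` traverse the grid one at a time: the `k`-th intermediate word is that of
`P_k`, and the letters that have left so far form the word of `Q_k`. The common outer shape of `P_k`
and `Q_k` ensures that the next cell of `Q` is addable. -/
theorem crsSeq_reads {T U : Filling d L} (hd : 1 ≤ d) (hT : T.IsStandard) (hU : U.IsStandard)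
    (hTU : T.inner = U.inner) (k : ℕ) (hk : k ≤ U.size) :
    (crsSeq T U k).1.Reads (prefixWord T.size (gridWord T.word U.word k)) T.size ∧
      (∀ i, (crsSeq T U k).1.inner.row i = addWord U.inner.row U.word k i) ∧
      ValidWord (crsSeq T U k).1.inner.row (gridWord T.word U.word k) T.size ∧
      (crsSeq T U k).2.Reads (prefixWord k (gridCarry T.word U.word T.size)) U.size ∧
      (crsSeq T U k).2.inner = T.outer ∧
      (crsSeq T U k).2.outer = (crsSeq T U k).1.outer := by
  induction k with
  | zero =>
    exact ⟨hT.reads hd, fun i => by simp [crsSeq, addWord, hTU], hT.validWord hd,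
      reads_empty _ _ _, rfl, rfl⟩
  | succ k ih =>
    obtain ⟨h1, h2, h3, h4, h5, h6⟩ := ih (by omega)
    have hadd : Addable (crsSeq T U k).1.inner.row (U.rowOf (k + 1) : ZMod d) := by
      intro i hi
      rw [h2, h2]
      exact hU.validWord hd k hk i hi
    obtain ⟨g1, g2, g3, g4, g5⟩ := internalInsert_reads hd h1 h3 hadd
    refine ⟨g1, fun i => ?_, ?_, ?_, h5, ?_⟩
    · simp only [crsSeq, g2, Shape.addCell_row hadd, h2, addWord_succ]
      rfl
    · simp only [crsSeq, g2]
      exact h3.passWord (Shape.row_le_pred _) hadd (Shape.addCell_row hadd)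
    · have happ := h4.append (r := ((crsSeq T U k).1.internalInsert (U.rowOf (k + 1))).2)
        (a := k) hk (by simp [prefixWord])
        (by
          intro l hl
          rw [ne_eq, prefixWord_eq_some]
          omega)
        (by rw [h6, g3]; exact g4)
      simp only [crsSeq]
      convert happ using 1
      funext l
      rcases lt_trichotomy l k with h | h | h
      · rw [Function.update_of_ne h.ne, prefixWord, prefixWord, if_pos h, if_pos (by omega)]
      · subst h
        rw [Function.update_self, g3, prefixWord, if_pos (by omega)]
        rfl
      · rw [Function.update_of_ne h.ne', prefixWord, prefixWord, if_neg (by omega),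
          if_neg (by omega)]
    · simp only [crsSeq, append, g5, h6]

theorem CRS_reads {T U : Filling d L} (hd : 1 ≤ d) (hT : T.IsStandard) (hU : U.IsStandard)
    (hTU : T.inner = U.inner) :
    (CRS T U).1.Reads (prefixWord T.size (gridWord T.word U.word U.size)) T.size ∧
      (CRS T U).1.inner = U.outer ∧
      (CRS T U).2.Reads (prefixWord U.size (gridCarry T.word U.word T.size)) U.size ∧
      (CRS T U).2.inner = T.outer := by
  obtain ⟨h1, h2, -, h4, h5, -⟩ := crsSeq_reads hd hT hU hTU U.size le_rfl
  refine ⟨h1, ?_, h4, h5⟩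
  ext i
  rw [CRS, h2, addWord_eq _ _ le_rfl, (hU.reads hd).outer]

theorem CRS_self {T : Filling d L} (hd : 1 ≤ d) (hT : T.IsStandard) :
    (CRS T T).1 = (CRS T T).2 := by
  obtain ⟨h1, h2, h3, h4⟩ := CRS_reads hd hT hT rfl
  rw [prefixWord_congr fun k _ => gridCarry_swap T.word T.word T.size k] at h3
  exact h1.eq h3 (h2.trans h4.symm)

/-- The words of the complements of `P` and `Q` enter the rotated grid, so those of the complements
of `T` and `U` leave it; the inner shapes match because complementation exchanges inner and outer.
-/
theorem CRS_complement {T U P Q : Filling d L} (hd : 1 ≤ d) (hT : T.IsStandard)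
    (hU : U.IsStandard) (hP : P.IsStandard) (hQ : Q.IsStandard) (hTU : T.inner = U.inner)
    (hPQ : P.outer = Q.outer) (h : CRS T U = (P, Q)) :
    CRS P.complement Q.complement = (T.complement, U.complement) := by
  obtain ⟨h1, h2, h3, h4⟩ := CRS_reads hd hT hU hTU
  rw [h] at h1 h2 h3 h4
  have hPn : P.size = T.size := h1.size_eq hd
  have hQm : Q.size = U.size := h3.size_eq hd
  obtain ⟨g1, g2, g3, g4⟩ := CRS_reads hd hP.complement hQ.complement
    (congrArg Shape.complement hPQ)
  rw [size_complement, size_complement, hPn, hQm] at g1 g3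
  obtain ⟨r1, r2⟩ := grid_reverse (t := T.word) (u := U.word) (t' := P.complement.word)
    (u' := Q.complement.word) (n := T.size) (m := U.size)
    (by
      intro j hj
      rw [hP.word_complement hd (by omega), hPn, hP.word_eq_of_reads hd h1 (by omega)])
    (by
      intro k hk
      rw [hQ.word_complement hd (by omega), hQm, hQ.word_eq_of_reads hd h3 (by omega)])
  have hTr := hT.complement.reads hd
  have hUr := hU.complement.reads hd
  rw [size_complement] at hTr hUr
  rw [prefixWord_congr fun k hk => (r1 k hk).trans (hT.word_complement hd hk).symm] at g1
  rw [prefixWord_congr fun k hk => (r2 k hk).trans (hU.word_complement hd hk).symm] at g3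
  exact Prod.ext (g1.eq hTr (g2.trans (congrArg Shape.complement h4)))
    (g3.eq hUr (g4.trans (congrArg Shape.complement h2)))

theorem CRS_eq_iff {T U P Q : Filling d L} (hd : 1 ≤ d) (hT : T.IsStandard)
    (hU : U.IsStandard) (hP : P.IsStandard) (hQ : Q.IsStandard) (hTU : T.inner = U.inner)
    (hPQ : P.outer = Q.outer) :
    CRS T U = (P, Q) ↔ CRS P.complement Q.complement = (T.complement, U.complement) := by
  refine ⟨CRS_complement hd hT hU hP hQ hTU hPQ, fun h => ?_⟩
  -- The converse is the same implication for the complements, complementation being an involution.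
  have := CRS_complement hd hP.complement hQ.complement hT.complement hU.complement
    (congrArg Shape.complement hPQ) (congrArg Shape.complement hTU) h
  rwa [hT.complement_complement, hU.complement_complement, hP.complement_complement,
    hQ.complement_complement] at this

/-- `Phi` keeps only the first component; `CRS_self` recovers the second. -/
theorem Phi_eq_iff {T P : Filling d L} (hd : 1 ≤ d) (hT : T.IsStandard) :
    Phi T = P ↔ CRS T T = (P, P) := by
  refine ⟨fun h => Prod.ext h ((CRS_self hd hT).symm.trans h), fun h => ?_⟩
  rw [Phi, h]

end Filling

end Cylindric

theorem mainTheorem10 (d L : ℕ) (hd : 1 ≤ d) (hL : 1 ≤ L) :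
    (∀ T U P Q : Cylindric.Filling d L,
      T.IsStandard → U.IsStandard → P.IsStandard → Q.IsStandard →
      T.inner = U.inner → P.outer = Q.outer →
      (Cylindric.Filling.CRS T U = (P, Q) ↔
        Cylindric.Filling.CRS P.complement Q.complement = (T.complement, U.complement))) ∧
    (∀ T P : Cylindric.Filling d L, T.IsStandard → P.IsStandard →
      (Cylindric.Filling.Phi T = P ↔ Cylindric.Filling.Phi P.complement = T.complement)) := by
  refine ⟨fun T U P Q hT hU hP hQ => Cylindric.Filling.CRS_eq_iff hd hT hU hP hQ,
    fun T P hT hP => ?_⟩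
  rw [Cylindric.Filling.Phi_eq_iff hd hT, Cylindric.Filling.Phi_eq_iff hd hP.complement]
  exact Cylindric.Filling.CRS_eq_iff hd hT hT hP hP rfl rfl
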